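/- A rooted tree with $n$ nodes is a tree with node set $[n]=\{1,\dots,n\}$ together with a distinguished node, its root. A node $v$ of a rooted tree is a record if $v$ is the largest label on the unique path from the root to $v$ (so the root is always a record). Let $R_\bullet(n,k)$ be the number of rooted trees with $n$ nodes and exactly $k$ records. Then for every integer $n\ge 1$, the greatest index $k$ that maximizes $R_\bullet(n,k)$, that is, the greatest $k$ with $R_\bullet(n,j)\le R_\bullet(n,k)$ for all $j$, is \[ k=\left\lfloor \frac{1+\sqrt{1+4n}}{2}\right\rfloor . \] -/

import Mathlib

/-- In the tree `T` rooted at `r`, with linearly ordered labels as vertices, the node `v` is a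
record if its label is the largest one along the path from the root `r` to `v`
(in a tree there is exactly one such path). -/
def IsTreeRecord {V : Type*} [LinearOrder V] (T : SimpleGraph V) (r v : V) : Prop :=
  ∀ p : T.Walk r v, p.IsPath → ∀ w ∈ p.support, w ≤ v

/-- The number of records of the tree `T` rooted at `r`. -/
noncomputable def numTreeRecords {V : Type*} [LinearOrder V] (T : SimpleGraph V) (r : V) : ℕ :=
  {v : V | IsTreeRecord T r v}.ncard

/-- The tree record number: the number of rooted labelled trees (pairs of a tree on the label set
and a root) with `n` nodes and `k` records. The labels `1 < 2 < ⋯ < n` are represented by the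
elements `0 < 1 < ⋯ < n - 1` of `Fin n`. -/
noncomputable def treeRecordNumber (n k : ℕ) : ℕ :=
  {P : SimpleGraph (Fin n) × Fin n | P.1.IsTree ∧ numTreeRecords P.1 P.2 = k}.ncard

open Finset Function
open scoped Classical

/-! Everything rests on the closed form $R(n,k)=k\,(n-1)_{k-1}\,n^{n-k-1}$ (falling factorial),
which is `recordCount`. Rooted trees are encoded as parent maps. If $k\ge1$ and a tree has $k+1$
records, its maximal label $m$ is not the root; cutting off the descendants of $m$ leaves a tree
with $k$ records, a branch rooted at $m$, and the node where it was attached. Nothing below $m$ is a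
record, so these data are free, and they give a recurrence over the size of the branch
(`card_recordMaps_succ`). Abel's binomial theorem shows that the closed form satisfies it
(`sum_choose_mul_recordCount`).

The recurrence does not reach $k=1$, the trees rooted at $m$. By symmetry among roots, all rooted
trees number $n\,R(n,1)$; the closed form sums by telescoping to $n^{n-1}$, and comparing the totals
gives $R(n,1)=n^{n-2}$, Cayley's formula (`card_recordMaps`).

Finally $R(n,k+1)/R(n,k)=(k+1)(n-k)/(nk)$ for $1\le k\le n$, which is at least 1 exactly when
$k(k+1)\le n$. So the last mode is the $K$ with $K(K-1)\le n<K(K+1)$. -/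

/-- `p` is the parent map of a rooted tree with node set `S` and root `r`, extended by the identity
outside `S`. -/
structure IsRootedMap {V : Type*} (S : Finset V) (r : V) (p : V → V) : Prop where
  root_mem : r ∈ S
  map_root : p r = r
  map_of_notMem : ∀ x ∉ S, p x = x
  map_mem : ∀ x ∈ S, p x ∈ S
  reach : ∀ x ∈ S, ∃ i, p^[i] x = r

/-- The nodes of `S` that are the largest among their ancestors under the parent map `p`. -/
noncomputable def recordSet {V : Type*} [LinearOrder V] (S : Finset V) (p : V → V) : Finset V :=
  {x ∈ S | ∀ i, p^[i] x ≤ x}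

/-- The parent maps of trees on `S` with root `r`. -/
noncomputable def rootedMaps {V : Type*} [DecidableEq V] [Fintype V] (S : Finset V) (r : V) : Finset (V → V) :=
  {p | IsRootedMap S r p}

/-- The parent maps of rooted trees on `S` with `k` records. -/
noncomputable def recordMaps {V : Type*} [LinearOrder V] [Fintype V] (S : Finset V) (k : ℕ) :
    Finset (V → V) :=
  {p | (∃ r, IsRootedMap S r p) ∧ #(recordSet S p) = k}

/-- The nodes of `S` having `m` as an ancestor. -/
noncomputable def descendants {V : Type*} (S : Finset V) (p : V → V) (m : V) : Finset V :=
  {x ∈ S | ∃ i, p^[i] x = m}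

/-! ### Parent maps: cutting off and grafting branches. -/

section RootedMaps

variable {V : Type*} {S A B : Finset V} {r m a x : V} {p q s : V → V}

theorem IsRootedMap.iterate_mem (h : IsRootedMap S r p) (hx : x ∈ S) (i : ℕ) : p^[i] x ∈ S := by
  induction i with
  | zero => exact hx
  | succ i ih => rw [iterate_succ_apply']; exact h.map_mem _ ih

theorem IsRootedMap.root_unique {r' : V} (h : IsRootedMap S r p) (h' : IsRootedMap S r' p) :
    r = r' := by
  obtain ⟨i, hi⟩ := h'.reach r h.root_mem
  rwa [iterate_fixed h.map_root] at hi

/-- Only the root is its own proper ancestor. -/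
theorem IsRootedMap.eq_root_of_iterate (h : IsRootedMap S r p) (hx : x ∈ S) {i : ℕ}
    (hi : p^[i] (p x) = x) : x = r := by
  obtain ⟨j, hj⟩ := h.reach x hx
  have hper : p^[i + 1] x = x := by rwa [iterate_succ_apply]
  -- Going $j$ times round the cycle through $x$ makes at least $j$ steps, hence ends at the root.
  have h1 : p^[(i + 1) * j] x = x := by
    rw [iterate_mul]; exact iterate_fixed hper j
  have h2 : (i + 1) * j = i * j + j := by ring
  rw [h2, iterate_add_apply, hj, iterate_fixed h.map_root] at h1
  exact h1.symm

theorem iterate_eq_of_eqOn (hq : ∀ x ∈ A, q x ∈ A) (hpq : ∀ x ∈ A, p x = q x) (hx : x ∈ A)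
    (i : ℕ) : p^[i] x = q^[i] x := by
  induction i generalizing x with
  | zero => rfl
  | succ i ih => rw [iterate_succ_apply, iterate_succ_apply, hpq x hx, ih (hq x hx)]

theorem IsRootedMap.conj (e : V ≃ V) (he : ∀ x, e x ∈ S ↔ x ∈ S) (h : IsRootedMap S r p) :
    IsRootedMap S (e r) (e ∘ p ∘ e.symm) := by
  have hit : ∀ (i : ℕ) (x : V), (e ∘ p ∘ e.symm)^[i] x = e (p^[i] (e.symm x)) := by
    intro i
    induction i with
    | zero => simp
    | succ i ih =>
      intro x
      rw [iterate_succ_apply, ih, iterate_succ_apply]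
      simp
  have hes : ∀ x, e.symm x ∈ S ↔ x ∈ S := fun x => by rw [← he, e.apply_symm_apply]
  refine ⟨(he r).2 h.root_mem, by simp [h.map_root], ?_, ?_, ?_⟩
  · intro x hx
    simp [h.map_of_notMem (e.symm x) (fun h' => hx ((hes x).1 h'))]
  · intro x hx
    exact (he _).2 (h.map_mem _ ((hes x).2 hx))
  · intro x hx
    obtain ⟨i, hi⟩ := h.reach _ ((hes x).2 hx)
    exact ⟨i, by rw [hit, hi]⟩

theorem mem_descendants : x ∈ descendants S p m ↔ x ∈ S ∧ ∃ i, p^[i] x = m := by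
  simp [descendants]

theorem IsRootedMap.root_notMem_descendants (h : IsRootedMap S r p) (hmr : m ≠ r) :
    r ∉ descendants S p m := by
  rw [mem_descendants]
  rintro ⟨-, i, hi⟩
  rw [iterate_fixed h.map_root] at hi
  exact hmr hi.symm

theorem map_notMem_descendants (hx : x ∈ S)
    (hxd : x ∉ descendants S p m) : p x ∉ descendants S p m := by
  rw [mem_descendants] at *
  rintro ⟨-, i, hi⟩
  exact hxd ⟨hx, i + 1, by rwa [iterate_succ_apply]⟩

theorem IsRootedMap.map_mem_descendants (h : IsRootedMap S r p)
    (hxd : x ∈ descendants S p m) (hxm : x ≠ m) : p x ∈ descendants S p m := by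
  rw [mem_descendants] at *
  obtain ⟨hx, i, hi⟩ := hxd
  refine ⟨h.map_mem _ hx, ?_⟩
  cases i with
  | zero => exact absurd hi hxm
  | succ i => exact ⟨i, by rwa [iterate_succ_apply] at hi⟩

theorem IsRootedMap.map_self_notMem_descendants (h : IsRootedMap S r p) (hm : m ∈ S)
    (hmr : m ≠ r) : p m ∉ descendants S p m := by
  rw [mem_descendants]
  rintro ⟨-, i, hi⟩
  exact hmr (h.eq_root_of_iterate hm hi)

variable [DecidableEq V]

/-- The part of the tree outside `B`. -/
noncomputable def pruned (B : Finset V) (p : V → V) : V → V := fun x => if x ∈ B then x else p x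

/-- The part of the tree in `B`, with `m` made a root. -/
noncomputable def branch (B : Finset V) (m : V) (p : V → V) : V → V :=
  fun x => if x ∈ B ∧ x ≠ m then p x else x

/-- The tree obtained by attaching a branch `s` on `B` with root `m` to the node `a` of `q`. -/
noncomputable def graft (B : Finset V) (m : V) (q s : V → V) (a : V) : V → V :=
  fun x => if x = m then a else if x ∈ B then s x else q x

theorem IsRootedMap.pruned (h : IsRootedMap S r p) (hmr : m ≠ r) :
    IsRootedMap (S \ descendants S p m) r (pruned (descendants S p m) p) := by
  have hmem : ∀ x ∈ S \ descendants S p m, _root_.pruned (descendants S p m) p x = p x := by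
    intro x hx
    simp [_root_.pruned, (mem_sdiff.1 hx).2]
  have hp : ∀ x ∈ S \ descendants S p m, p x ∈ S \ descendants S p m := fun x hx =>
    mem_sdiff.2 ⟨h.map_mem _ (mem_sdiff.1 hx).1,
      map_notMem_descendants (mem_sdiff.1 hx).1 (mem_sdiff.1 hx).2⟩
  have hr := mem_sdiff.2 ⟨h.root_mem, h.root_notMem_descendants hmr⟩
  refine ⟨hr, ?_, ?_, ?_, ?_⟩
  · rw [hmem r hr, h.map_root]
  · intro x hx
    by_cases hd : x ∈ descendants S p m
    · simp [_root_.pruned, hd]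
    · have : x ∉ S := fun hS => hx (mem_sdiff.2 ⟨hS, hd⟩)
      simp [_root_.pruned, hd, h.map_of_notMem x this]
  · intro x hx
    rw [hmem x hx]
    exact hp x hx
  · intro x hx
    obtain ⟨i, hi⟩ := h.reach x (mem_sdiff.1 hx).1
    exact ⟨i, by rwa [iterate_eq_of_eqOn hp hmem hx]⟩

theorem IsRootedMap.branch (h : IsRootedMap S r p) (hm : m ∈ S) :
    IsRootedMap (descendants S p m) m (branch (descendants S p m) m p) := by
  refine ⟨mem_descendants.2 ⟨hm, 0, rfl⟩, by simp [_root_.branch], ?_, ?_, ?_⟩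
  · intro x hx
    simp [_root_.branch, hx]
  · intro x hx
    by_cases hxm : x = m
    · simpa [_root_.branch, hxm] using mem_descendants.2 ⟨hm, 0, rfl⟩
    · simpa [_root_.branch, hx, hxm] using h.map_mem_descendants hx hxm
  · intro x hx
    obtain ⟨i, hi⟩ := (mem_descendants.1 hx).2
    induction i generalizing x with
    | zero => exact ⟨0, hi⟩
    | succ i ih =>
      by_cases hxm : x = m
      · exact ⟨0, hxm⟩
      · obtain ⟨j, hj⟩ := ih (p x) (h.map_mem_descendants hx hxm) (by rwa [iterate_succ_apply] at hi)
        refine ⟨j + 1, ?_⟩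
        rw [iterate_succ_apply]
        simpa [_root_.branch, hx, hxm] using hj

theorem graft_pruned_branch : graft B m (pruned B p) (branch B m p) (p m) = p := by
  funext x
  by_cases hxm : x = m
  · simp [graft, hxm]
  · by_cases hx : x ∈ B <;> simp [graft, pruned, branch, hx, hxm]

/-- Parent maps are the identity off their node set, so cutting inverts grafting as an equality of
functions on all of `V`. -/
theorem pruned_graft (hq : IsRootedMap (S \ B) r q) (hm : m ∈ B) :
    pruned B (graft B m q s a) = q := by
  funext x
  by_cases hx : x ∈ B
  · simp [pruned, hx, hq.map_of_notMem x (fun h => (mem_sdiff.1 h).2 hx)]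
  · have : x ≠ m := fun h => hx (h ▸ hm)
    simp [graft, pruned, hx, this]

theorem branch_graft (hs : IsRootedMap B m s) : branch B m (graft B m q s a) = s := by
  funext x
  by_cases hxm : x = m
  · simp [branch, hxm, hs.map_root]
  · by_cases hx : x ∈ B
    · simp [graft, branch, hx, hxm]
    · simp [branch, hx, hs.map_of_notMem x hx]

theorem graft_self : graft B m q s a m = a := by simp [graft]

theorem graft_of_mem_sdiff (hB : m ∈ B) (hx : x ∈ S \ B) : graft B m q s a x = q x := by
  have hxB := (mem_sdiff.1 hx).2
  have : x ≠ m := fun h => hxB (h ▸ hB)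
  simp [graft, hxB, this]

theorem graft_of_mem (hx : x ∈ B) (hxm : x ≠ m) : graft B m q s a x = s x := by
  simp [graft, hx, hxm]

theorem exists_iterate_graft (hs : IsRootedMap B m s) (hx : x ∈ B) :
    ∃ i, (graft B m q s a)^[i] x = m := by
  obtain ⟨i, hi⟩ := hs.reach x hx
  induction i generalizing x with
  | zero => exact ⟨0, hi⟩
  | succ i ih =>
    by_cases hxm : x = m
    · exact ⟨0, hxm⟩
    · obtain ⟨j, hj⟩ := ih (hs.map_mem x hx) (by rwa [iterate_succ_apply] at hi)
      exact ⟨j + 1, by rw [iterate_succ_apply, graft_of_mem hx hxm, hj]⟩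

theorem IsRootedMap.graft (hBS : B ⊆ S) (hq : IsRootedMap (S \ B) r q) (hs : IsRootedMap B m s)
    (ha : a ∈ S \ B) : IsRootedMap S r (graft B m q s a) := by
  have hm := hs.root_mem
  have hA : ∀ x ∈ S \ B, ∃ i, (_root_.graft B m q s a)^[i] x = r := by
    intro x hx
    obtain ⟨i, hi⟩ := hq.reach x hx
    exact ⟨i, by rwa [iterate_eq_of_eqOn hq.map_mem (fun y hy => graft_of_mem_sdiff hm hy) hx]⟩
  refine ⟨(mem_sdiff.1 hq.root_mem).1, ?_, ?_, ?_, ?_⟩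
  · rw [graft_of_mem_sdiff hm hq.root_mem, hq.map_root]
  · intro x hx
    have hxB : x ∉ B := fun h => hx (hBS h)
    have hxm : x ≠ m := fun h => hxB (h ▸ hm)
    simp [_root_.graft, hxB, hxm, hq.map_of_notMem x (fun h => hx (mem_sdiff.1 h).1)]
  · intro x hx
    by_cases hxB : x ∈ B
    · by_cases hxm : x = m
      · rw [hxm, graft_self]; exact (mem_sdiff.1 ha).1
      · rw [graft_of_mem hxB hxm]; exact hBS (hs.map_mem x hxB)
    · have hxA := mem_sdiff.2 ⟨hx, hxB⟩
      rw [graft_of_mem_sdiff hm hxA]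
      exact (mem_sdiff.1 (hq.map_mem x hxA)).1
  · intro x hx
    by_cases hxB : x ∈ B
    · obtain ⟨i, hi⟩ := exists_iterate_graft (q := q) (a := a) hs hxB
      obtain ⟨j, hj⟩ := hA a ha
      refine ⟨j + (1 + i), ?_⟩
      rw [iterate_add_apply, iterate_add_apply, hi, iterate_one, graft_self, hj]
    · exact hA x (mem_sdiff.2 ⟨hx, hxB⟩)

theorem descendants_graft (hBS : B ⊆ S) (hq : IsRootedMap (S \ B) r q) (hs : IsRootedMap B m s) :
    descendants S (graft B m q s a) m = B := by
  ext x
  rw [mem_descendants]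
  constructor
  · rintro ⟨hx, i, hi⟩
    by_contra hxB
    have hxA := mem_sdiff.2 ⟨hx, hxB⟩
    rw [iterate_eq_of_eqOn hq.map_mem
      (fun y hy => graft_of_mem_sdiff hs.root_mem hy) hxA] at hi
    have := hq.iterate_mem hxA i
    rw [hi] at this
    exact (mem_sdiff.1 this).2 hs.root_mem
  · exact fun hx => ⟨hBS hx, exists_iterate_graft hs hx⟩

/-- Conjugating by the transposition of the two roots is injective and carries one root to the
other. -/
theorem card_rootedMaps_le [Fintype V] {r' : V} (hr : r ∈ S) (hr' : r' ∈ S) :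
    #(rootedMaps S r) ≤ #(rootedMaps S r') := by
  have he : ∀ x, Equiv.swap r r' x ∈ S ↔ x ∈ S := by
    intro x
    rcases eq_or_ne x r with rfl | h1
    · simp [hr, hr']
    · rcases eq_or_ne x r' with rfl | h2
      · simp [hr, hr']
      · rw [Equiv.swap_apply_of_ne_of_ne h1 h2]
  refine card_le_card_of_injOn (fun p => Equiv.swap r r' ∘ p ∘ (Equiv.swap r r').symm) ?_ ?_
  · intro p hp
    have := (mem_filter.1 hp).2.conj (Equiv.swap r r') he
    rw [Equiv.swap_apply_left] at this
    exact mem_filter.2 ⟨mem_univ _, this⟩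
  · intro p _ q _ h
    funext x
    have := congrFun h (Equiv.swap r r' x)
    simpa using this

theorem card_rootedMaps_eq [Fintype V] {r' : V} (hr : r ∈ S) (hr' : r' ∈ S) :
    #(rootedMaps S r) = #(rootedMaps S r') :=
  (card_rootedMaps_le hr hr').antisymm (card_rootedMaps_le hr' hr)

theorem rootedMaps_singleton [Fintype V] : rootedMaps {r} r = {id} := by
  ext p
  simp only [rootedMaps, mem_filter, mem_univ, true_and, mem_singleton]
  constructor
  · intro h
    funext x
    by_cases hx : x = r
    · rw [hx, h.map_root, id]
    · exact h.map_of_notMem x (by simpa using hx)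
  · rintro rfl
    exact ⟨by simp, rfl, fun _ _ => rfl, fun _ h => h, fun x hx => ⟨0, by simpa using hx⟩⟩

end RootedMaps

/-! ### Records and the recurrence from the maximal label. -/

section Records

variable {V : Type*} [LinearOrder V] {S B : Finset V} {r m a x : V} {p q s : V → V}

theorem mem_recordSet : x ∈ recordSet S p ↔ x ∈ S ∧ ∀ i, p^[i] x ≤ x := by
  simp [recordSet]

theorem IsRootedMap.root_mem_recordSet (h : IsRootedMap S r p) : r ∈ recordSet S p :=
  mem_recordSet.2 ⟨h.root_mem, fun i => (iterate_fixed h.map_root i).le⟩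

theorem IsRootedMap.max_mem_recordSet (h : IsRootedMap S r p) (hm : m ∈ S)
    (hmax : ∀ x ∈ S, x ≤ m) : m ∈ recordSet S p :=
  mem_recordSet.2 ⟨hm, fun i => hmax _ (h.iterate_mem hm i)⟩

theorem IsRootedMap.recordSet_eq_singleton (h : IsRootedMap S m p) (hmax : ∀ x ∈ S, x ≤ m) :
    recordSet S p = {m} := by
  refine subset_antisymm (fun x hx => ?_) (singleton_subset_iff.2 h.root_mem_recordSet)
  obtain ⟨hx, hi⟩ := mem_recordSet.1 hx
  obtain ⟨i, hi'⟩ := h.reach x hx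
  exact mem_singleton.2 ((hmax x hx).antisymm (hi' ▸ hi i))

/-- Every node of the branch has the maximum `m` as an ancestor, so only `m` itself can be a record
there; ancestors of nodes outside the branch do not change. -/
theorem recordSet_graft (hBS : B ⊆ S) (hmax : ∀ x ∈ S, x ≤ m)
    (hq : IsRootedMap (S \ B) r q) (hs : IsRootedMap B m s) (ha : a ∈ S \ B) :
    recordSet S (graft B m q s a) = insert m (recordSet (S \ B) q) := by
  have hm := hs.root_mem
  have hp := IsRootedMap.graft hBS hq hs ha
  have hit : ∀ x ∈ S \ B, ∀ i, (graft B m q s a)^[i] x = q^[i] x := fun x hx i =>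
    iterate_eq_of_eqOn hq.map_mem (fun y hy => graft_of_mem_sdiff hm hy) hx i
  ext x
  rw [mem_insert]
  constructor
  · intro hx
    obtain ⟨hxS, hi⟩ := mem_recordSet.1 hx
    by_cases hxB : x ∈ B
    · obtain ⟨i, hi'⟩ := exists_iterate_graft (q := q) (a := a) hs hxB
      exact Or.inl ((hmax x hxS).antisymm (hi' ▸ hi i))
    · have hxA := mem_sdiff.2 ⟨hxS, hxB⟩
      exact Or.inr (mem_recordSet.2 ⟨hxA, fun i => hit x hxA i ▸ hi i⟩)
  · rintro (rfl | hx)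
    · exact hp.max_mem_recordSet (hBS hm) hmax
    · obtain ⟨hxA, hi⟩ := mem_recordSet.1 hx
      exact mem_recordSet.2 ⟨(mem_sdiff.1 hxA).1, fun i => (hit x hxA i).symm ▸ hi i⟩

theorem card_recordSet_graft (hBS : B ⊆ S) (hmax : ∀ x ∈ S, x ≤ m)
    (hq : IsRootedMap (S \ B) r q) (hs : IsRootedMap B m s) (ha : a ∈ S \ B) :
    #(recordSet S (graft B m q s a)) = #(recordSet (S \ B) q) + 1 := by
  rw [recordSet_graft hBS hmax hq hs ha, card_insert_of_notMem]
  exact fun h => (mem_sdiff.1 (mem_recordSet.1 h).1).2 hs.root_mem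

theorem mem_rootedMaps {V : Type*} [DecidableEq V] [Fintype V] {S : Finset V} {r : V} {p : V → V} :
    p ∈ rootedMaps S r ↔ IsRootedMap S r p := by
  simp [rootedMaps]

variable [Fintype V]

theorem mem_recordMaps {k : ℕ} :
    p ∈ recordMaps S k ↔ (∃ r, IsRootedMap S r p) ∧ #(recordSet S p) = k := by
  simp [recordMaps]

/-- The root and the maximum are both records, so a single record forces them to coincide. -/
theorem recordMaps_one (hm : m ∈ S) (hmax : ∀ x ∈ S, x ≤ m) :
    recordMaps S 1 = rootedMaps S m := by
  ext p
  rw [mem_recordMaps, mem_rootedMaps]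
  constructor
  · rintro ⟨⟨r, h⟩, h1⟩
    obtain ⟨y, hy⟩ := card_eq_one.1 h1
    have h2 := h.root_mem_recordSet
    have h3 := h.max_mem_recordSet hm hmax
    rw [hy, mem_singleton] at h2 h3
    rwa [h3, ← h2]
  · intro h
    exact ⟨⟨m, h⟩, by rw [h.recordSet_eq_singleton hmax, card_singleton]⟩

/-- Cutting at `m` and grafting are mutually inverse. The condition `k ≠ 0` gives at least two
records, so `m` is not the root and has a parent outside its branch. -/
theorem card_recordMaps_filter_descendants {k : ℕ} (hk : k ≠ 0) (hBS : B ⊆ S) (hmB : m ∈ B)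
    (hmax : ∀ x ∈ S, x ≤ m) :
    #{p ∈ recordMaps S (k + 1) | descendants S p m = B} =
      #(recordMaps (S \ B) k) * (#(rootedMaps B m) * #(S \ B)) := by
  rw [← card_product, ← card_product]
  refine card_nbij' (fun p => (pruned B p, branch B m p, p m))
    (fun t => graft B m t.1 t.2.1 t.2.2) ?_ ?_ ?_ ?_
  · intro p hp
    obtain ⟨hpk, rfl⟩ := mem_filter.1 (mem_coe.1 hp)
    obtain ⟨⟨r, h⟩, hc⟩ := mem_recordMaps.1 hpk
    have hmS := hBS hmB
    have hmr : m ≠ r := by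
      rintro rfl
      rw [h.recordSet_eq_singleton hmax, card_singleton] at hc
      omega
    have ha : p m ∈ S \ descendants S p m :=
      mem_sdiff.2 ⟨h.map_mem _ hmS, h.map_self_notMem_descendants hmS hmr⟩
    refine mem_product.2 ⟨mem_recordMaps.2 ⟨⟨r, h.pruned hmr⟩, ?_⟩,
      mem_product.2 ⟨mem_rootedMaps.2 (h.branch hmS), ha⟩⟩
    have := card_recordSet_graft hBS hmax (h.pruned hmr) (h.branch hmS) ha
    rw [graft_pruned_branch, hc] at this
    exact (Nat.succ_injective this).symm
  · rintro ⟨q, s, a⟩ ht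
    obtain ⟨hq, ht⟩ := mem_product.1 ht
    obtain ⟨hs, ha⟩ := mem_product.1 ht
    obtain ⟨⟨r, hq⟩, hc⟩ := mem_recordMaps.1 hq
    have hs := mem_rootedMaps.1 hs
    refine mem_filter.2 ⟨mem_recordMaps.2 ⟨⟨r, IsRootedMap.graft hBS hq hs ha⟩, ?_⟩, ?_⟩
    · rw [card_recordSet_graft hBS hmax hq hs ha, hc]
    · exact descendants_graft hBS hq hs
  · intro p _
    exact graft_pruned_branch
  · rintro ⟨q, s, a⟩ ht
    obtain ⟨hq, ht⟩ := mem_product.1 ht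
    obtain ⟨hs, ha⟩ := mem_product.1 ht
    obtain ⟨⟨r, hq⟩, hc⟩ := mem_recordMaps.1 hq
    have hs := mem_rootedMaps.1 hs
    exact Prod.ext (pruned_graft hq hmB) (Prod.ext (branch_graft hs) graft_self)

theorem card_recordMaps_succ {k : ℕ} (hk : k ≠ 0) (hm : m ∈ S) (hmax : ∀ x ∈ S, x ≤ m) :
    #(recordMaps S (k + 1)) = ∑ D ∈ (S.erase m).powerset,
      #(recordMaps (S \ insert m D) k) *
        (#(rootedMaps (insert m D) m) * #(S \ insert m D)) := by
  -- Erasing `m` lets the index run over all subsets of `S.erase m`, so that grouping by size later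
  -- gives binomial coefficients.
  rw [card_eq_sum_card_fiberwise (f := fun p => (descendants S p m).erase m)
    (t := (S.erase m).powerset)]
  · refine sum_congr rfl fun D hD => ?_
    have hD := mem_powerset.1 hD
    have hmD : m ∉ D := fun h => notMem_erase m S (hD h)
    rw [← card_recordMaps_filter_descendants hk
      (insert_subset hm (hD.trans (erase_subset _ _))) (mem_insert_self _ _) hmax]
    congr 1
    refine filter_congr fun p _ => ?_
    have : m ∈ descendants S p m := mem_descendants.2 ⟨hm, 0, rfl⟩
    constructor
    · intro h
      rw [← h, insert_erase this]
    · intro h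
      rw [h, erase_insert hmD]
  · intro p _
    exact mem_coe.2 (mem_powerset.2 (erase_subset_erase _ (filter_subset _ _)))

/-- All roots are equally likely. -/
theorem sum_card_recordMaps (hm : m ∈ S) :
    ∑ k ∈ range (#S + 1), #(recordMaps S k) = #S * #(rootedMaps S m) := by
  have h1 : ∑ k ∈ range (#S + 1), #(recordMaps S k) = #{p : V → V | ∃ r, IsRootedMap S r p} := by
    rw [card_eq_sum_card_fiberwise (f := fun p => #(recordSet S p)) (t := range (#S + 1))]
    · refine sum_congr rfl fun k _ => ?_
      rw [filter_filter]
      rfl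
    · intro p _
      exact mem_coe.2 (mem_range.2 (Nat.lt_succ_of_le (card_le_card (filter_subset _ _))))
  have h2 : ({p : V → V | ∃ r, IsRootedMap S r p} : Finset _) =
      S.biUnion (fun r => rootedMaps S r) := by
    ext p
    simp only [mem_filter, mem_univ, true_and, mem_biUnion, mem_rootedMaps]
    exact ⟨fun ⟨r, h⟩ => ⟨r, h.root_mem, h⟩, fun ⟨r, _, h⟩ => ⟨r, h⟩⟩
  rw [h1, h2, card_biUnion, sum_congr rfl (fun r hr => card_rootedMaps_eq hr hm), sum_const,
    smul_eq_mul]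
  intro r _ r' _ hne
  exact disjoint_left.2 fun p hp hp' => hne ((mem_rootedMaps.1 hp).root_unique (mem_rootedMaps.1 hp'))

end Records

/-! ### Abel's binomial theorem. -/

section Abel

open Polynomial

/-- The Abel polynomials `x (x + n) ^ (n - 1)`. -/
noncomputable def abelPoly : ℕ → ℚ[X]
  | 0 => 1
  | n + 1 => X * (X + C ((n : ℚ) + 1)) ^ n

theorem abelPoly_zero : abelPoly 0 = 1 := rfl

theorem derivative_abelPoly_succ (n : ℕ) :
    derivative (abelPoly (n + 1)) = C ((n : ℚ) + 1) * (abelPoly n).comp (X + 1) := by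
  cases n with
  | zero => simp [abelPoly]
  | succ n =>
    rw [abelPoly, derivative_mul, derivative_X, derivative_X_add_C_pow]
    simp only [abelPoly, mul_comp, X_comp, pow_comp, add_comp, C_comp, Nat.cast_add, Nat.cast_one,
      add_tsub_cancel_right, C_add, C_1, one_comp]
    ring

theorem eval_zero_abelPoly_succ (n : ℕ) : (abelPoly (n + 1)).eval 0 = 0 := by
  simp [abelPoly]

theorem eq_of_derivative_eq {f g : ℚ[X]} (h : derivative f = derivative g)
    (h0 : f.eval 0 = g.eval 0) : f = g := by
  have h1 : derivative (f - g) = 0 := by rw [derivative_sub, h, sub_self]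
  have h2 := eq_C_of_natDegree_eq_zero (derivative_eq_zero.1 h1)
  have h3 : (f - g).coeff 0 = 0 := by rw [coeff_zero_eq_eval_zero, eval_sub, h0, sub_self]
  rw [h3, C_0] at h2
  exact sub_eq_zero.1 h2

/-- The Abel polynomials are of binomial type, as an identity of polynomials in one variable. -/
theorem sum_choose_mul_abelPoly (y : ℚ) (n : ℕ) :
    ∑ t ∈ antidiagonal n, C (n.choose t.1 * (abelPoly t.2).eval y) * abelPoly t.1 =
      (abelPoly n).comp (X + C y) := by
  induction n with
  | zero => simp [abelPoly]
  | succ n ih =>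
    -- Differentiation lowers the index and shifts the argument by 1, which reduces to the induction
    -- hypothesis. At 0 only the term of index 0 survives.
    apply eq_of_derivative_eq
    · rw [derivative_comp, derivative_abelPoly_succ, Nat.sum_antidiagonal_succ, derivative_add,
        derivative_sum, mul_comp, Polynomial.comp_assoc]
      have h : ((X : ℚ[X]) + 1).comp (X + C y) = (X + C y).comp (X + 1) := by
        simp only [add_comp, X_comp, C_comp, one_comp]; ring
      rw [h, ← Polynomial.comp_assoc, ← ih, Polynomial.sum_comp, mul_sum]
      simp only [abelPoly_zero, derivative_mul, derivative_C, zero_mul, derivative_one, mul_zero,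
        add_zero, zero_add, derivative_add, derivative_X, one_mul, C_comp,
        derivative_abelPoly_succ]
      refine sum_congr rfl fun t _ => ?_
      have hc : (((n + 1).choose (t.1 + 1) : ℕ) : ℚ) * (t.1 + 1) = (n + 1) * n.choose t.1 := by
        exact_mod_cast (Nat.add_one_mul_choose_eq n t.1).symm
      rw [mul_comp, C_comp, ← mul_assoc, ← mul_assoc, ← C_mul, ← C_mul, mul_right_comm, hc,
        mul_assoc]
    · rw [Nat.sum_antidiagonal_succ, eval_add, eval_finsetSum, sum_eq_zero]
      · simp [abelPoly]
      · intro t _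
        rw [eval_mul, eval_zero_abelPoly_succ, mul_zero]

/-- Abel's binomial theorem. -/
theorem sum_choose_mul_eval_abelPoly (x y : ℚ) (n : ℕ) :
    ∑ t ∈ antidiagonal n, n.choose t.1 * (abelPoly t.2).eval y * (abelPoly t.1).eval x =
      (abelPoly n).eval (x + y) := by
  have := congrArg (Polynomial.eval x) (sum_choose_mul_abelPoly y n)
  simpa [eval_finsetSum] using this

theorem eval_abelPoly (n : ℕ) {x : ℚ} (hx : 0 < x) :
    (abelPoly n).eval x = x * (x + n) ^ n / (x + n) := by
  have : x + n ≠ 0 := by positivity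
  cases n with
  | zero => simp [abelPoly, hx.ne']
  | succ n =>
    rw [eq_div_iff this]
    simp [abelPoly]
    ring

end Abel

/-! ### Algebra of the closed form. -/

/-- The closed form of the tree record numbers. -/
noncomputable def recordCount (n k : ℕ) : ℚ :=
  -- The quotient stands for $n^{n-k-1}$, whose exponent is $-1$ at $k=n$.
  k * (n - 1).descFactorial (k - 1) * n ^ n / n ^ (k + 1)

theorem recordCount_zero (n : ℕ) : recordCount n 0 = 0 := by simp [recordCount]

theorem recordCount_one (n : ℕ) : recordCount n 1 = n ^ n / n ^ 2 := by simp [recordCount]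

theorem recordCount_add_mul {k : ℕ} (hk : k ≠ 0) (b : ℕ) :
    recordCount (b + k) k * (b + k : ℕ) =
      (b + k).descFactorial k * (abelPoly b).eval (k : ℚ) := by
  obtain ⟨k, rfl⟩ := Nat.exists_eq_succ_of_ne_zero hk
  have h0 : ((k.succ : ℚ)) + b ≠ 0 := by positivity
  rw [eval_abelPoly b (by positivity), recordCount, show b + k.succ = b + k + 1 from rfl,
    Nat.succ_descFactorial_succ]
  simp only [Nat.add_sub_cancel, Nat.succ_eq_add_one]
  push_cast at h0 ⊢
  have h1 : (b : ℚ) + k + 1 = k + 1 + b := by ring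
  rw [h1, show b + k + 1 = b + (k + 1) by ring, pow_add]
  field_simp
  ring

theorem recordCount_eq_zero_of_lt {n k : ℕ} (h : n < k) : recordCount n k * n = 0 := by
  rcases Nat.eq_zero_or_pos n with rfl | hn
  · simp
  · simp [recordCount, Nat.descFactorial_of_lt (show n - 1 < k - 1 by omega)]

/-- Both sides count pairs of an $a$-subset and a disjoint ordered $k$-list, chosen in either order.
-/
theorem choose_mul_descFactorial_sub (M k a : ℕ) :
    (M + k).choose a * (M + k - a).descFactorial k = (M + k).descFactorial k * M.choose a := by
  rw [Nat.descFactorial_eq_factorial_mul_choose, Nat.descFactorial_eq_factorial_mul_choose]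
  have h1 := Nat.choose_mul (n := M + k) (k := a + k) (s := a) (by omega)
  have h2 := Nat.choose_mul (n := M + k) (k := a + k) (s := k) (by omega)
  rw [Nat.add_sub_cancel_left] at h1
  rw [Nat.add_sub_cancel, Nat.add_sub_cancel] at h2
  rw [Nat.choose_symm_add] at h1
  rw [mul_left_comm, ← h1, h2]
  ring

theorem sum_choose_mul_recordCount (N : ℕ) {k : ℕ} (hk : k ≠ 0) :
    ∑ a ∈ range (N + 1), N.choose a •
      (recordCount (N - a) k * (recordCount (a + 1) 1 * (N - a : ℕ))) =
      recordCount (N + 1) (k + 1) := by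
  have hre : ∀ a, recordCount (N - a) k * (recordCount (a + 1) 1 * (N - a : ℕ)) =
      recordCount (N - a) k * (N - a : ℕ) * recordCount (a + 1) 1 := fun a => by ring
  rcases lt_or_ge N k with hN | hN
  · rw [sum_eq_zero]
    · simp [recordCount, Nat.descFactorial_of_lt hN]
    · intro a _
      rw [hre, recordCount_eq_zero_of_lt (by omega), zero_mul, smul_zero]
  · obtain ⟨M, rfl⟩ := Nat.exists_eq_add_of_le' hN
    -- For $a>M$ fewer than $k$ nodes remain outside the branch, so the term is zero. The rest is
    -- Abel's identity at $1$ and $k$.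
    rw [← sum_subset (range_subset_range.2 (show M + 1 ≤ M + k + 1 by omega))]
    · have key : ∀ a ∈ range (M + 1), (M + k).choose a •
          (recordCount (M + k - a) k * (recordCount (a + 1) 1 * (M + k - a : ℕ))) =
          (M + k).descFactorial k *
            (M.choose a * (abelPoly (M - a)).eval (k : ℚ) * (abelPoly a).eval 1) := by
        intro a ha
        have ha : a ≤ M := Nat.lt_succ_iff.1 (mem_range.1 ha)
        have hc : (((M + k).choose a : ℕ) : ℚ) * (M + k - a).descFactorial k =
            (M + k).descFactorial k * M.choose a := by
          exact_mod_cast choose_mul_descFactorial_sub M k a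
        have h1 : recordCount (a + 1) 1 = (abelPoly a).eval 1 := by
          rw [recordCount_one, eval_abelPoly a one_pos]
          push_cast
          rw [add_comm (1 : ℚ)]
          field_simp
          ring
        have h2 : M + k - a = (M - a) + k := by omega
        rw [hre, h1, nsmul_eq_mul]
        rw [h2] at hc ⊢
        rw [recordCount_add_mul hk, ← mul_assoc, ← mul_assoc, hc]
        ring
      have hA := sum_choose_mul_eval_abelPoly 1 (k : ℚ) M
      rw [Nat.sum_antidiagonal_eq_sum_range_succ_mk] at hA
      rw [sum_congr rfl key, ← mul_sum, hA, eval_abelPoly M (by positivity), recordCount]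
      simp only [Nat.add_sub_cancel]
      push_cast
      rw [show (1 : ℚ) + k + M = M + k + 1 by ring, show M + k + 1 = M + (k + 1) by ring,
        show k + 1 + 1 = (k + 1) + 1 by ring, pow_add _ M, pow_succ _ (k + 1)]
      field_simp
      ring
    · intro a _ ha
      have : M < a := by simpa using ha
      rw [hre, recordCount_eq_zero_of_lt (by omega), zero_mul, smul_zero]

/-- Telescoping: for $k\ge1$ the summand is $f(k-1)-f(k)$ with $f(k)=(n-1)_k\,n^{n-k-1}$, and $f$
vanishes from $k=n$ on. -/
theorem sum_range_recordCount (n : ℕ) (hn : 1 ≤ n) (K : ℕ) :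
    ∑ k ∈ range (K + 1), recordCount n k =
      n ^ n / n - (n - 1).descFactorial K * n ^ n / n ^ (K + 1) := by
  have hn0 : (n : ℚ) ≠ 0 := by positivity
  induction K with
  | zero => simp [recordCount]
  | succ K ih =>
    rw [sum_range_succ, ih, recordCount, Nat.descFactorial_succ]
    simp only [Nat.add_sub_cancel]
    rcases le_or_gt K (n - 1) with h | h
    · have : ((n - 1 - K : ℕ) : ℚ) = n - 1 - K := by
        rw [Nat.cast_sub h, Nat.cast_sub hn, Nat.cast_one]
      push_cast
      rw [this]
      field_simp
      ring
    · simp [Nat.descFactorial_of_lt h]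

theorem recordCount_succ_mul {n k : ℕ} (hk : 1 ≤ k) (hkn : k ≤ n) :
    recordCount n (k + 1) * (n * k) = recordCount n k * ((k + 1) * (n - k)) := by
  have hn0 : (n : ℚ) ≠ 0 := by
    have : 0 < n := by omega
    positivity
  obtain ⟨j, rfl⟩ := Nat.exists_eq_add_of_le' hk
  have : ((n - 1 - j : ℕ) : ℚ) = n - (j + 1) := by
    rw [Nat.sub_sub, Nat.cast_sub (by omega)]; push_cast; ring
  simp only [recordCount, Nat.add_sub_cancel]
  rw [Nat.descFactorial_succ]
  push_cast
  rw [this]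
  field_simp
  ring

/-! ### Proof of the closed form for parent maps. -/

section Count

variable {V : Type*} [LinearOrder V] [Fintype V]

theorem recordMaps_zero (S : Finset V) : recordMaps S 0 = ∅ := by
  rw [eq_empty_iff_forall_notMem]
  intro p hp
  obtain ⟨⟨r, h⟩, hc⟩ := mem_recordMaps.1 hp
  have := h.root_mem_recordSet
  rw [card_eq_zero.1 hc] at this
  exact notMem_empty _ this

theorem card_recordMaps (S : Finset V) (hS : S.Nonempty) (k : ℕ) :
    (#(recordMaps S k) : ℚ) = recordCount #S k := by
  induction hn : #S using Nat.strong_induction_on generalizing S k with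
  | _ n ih =>
  subst hn
  obtain ⟨m, hm, hmax⟩ : ∃ m ∈ S, ∀ x ∈ S, x ≤ m := ⟨S.max' hS, S.max'_mem hS, S.le_max'⟩
  have hpos : 1 ≤ #S := hS.card_pos
  have hroot : ∀ B : Finset V, #B < #S → m ∈ B → (∀ x ∈ B, x ≤ m) →
      (#(rootedMaps B m) : ℚ) = recordCount #B 1 := by
    intro B hB hmB hmaxB
    rw [← recordMaps_one hmB hmaxB]
    exact ih _ hB B ⟨m, hmB⟩ 1 rfl
  have hsucc : ∀ k ≠ 0, (#(recordMaps S (k + 1)) : ℚ) = recordCount #S (k + 1) := by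
    intro k hk
    have hcard : #(S.erase m) = #S - 1 := card_erase_of_mem hm
    have hsub : #S = #S - 1 + 1 := by omega
    rw [card_recordMaps_succ hk hm hmax, Nat.cast_sum, hsub, ← sum_choose_mul_recordCount _ hk,
      ← hcard, ← sum_powerset_apply_card (fun a => recordCount (#(S.erase m) - a) k *
        (recordCount (a + 1) 1 * ((#(S.erase m) - a : ℕ) : ℚ)))]
    refine sum_congr rfl fun D hD => ?_
    have hD := mem_powerset.1 hD
    have hmD : m ∉ D := fun h => notMem_erase m S (hD h)
    have hBS : insert m D ⊆ S := insert_subset hm (hD.trans (erase_subset _ _))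
    have hle := card_le_card hD
    have h1 : #(insert m D) = #D + 1 := card_insert_of_notMem hmD
    have h2 : #(S \ insert m D) = #(S.erase m) - #D := by
      rw [card_sdiff_of_subset hBS, h1, hcard]; omega
    push_cast
    rw [h2]
    -- If the branch is all of `S`, no attachment node exists and both sides are zero; otherwise
    -- induction applies to both pieces.
    rcases eq_or_lt_of_le hle with h | h
    · simp [h]
    · rw [hroot _ (by omega) (mem_insert_self _ _) (fun x hx => hmax x (hBS hx)),
        ih _ (by omega) _ (card_pos.1 (by omega)) k h2, h1]
  match k with
  | 0 => simp [recordMaps_zero, recordCount_zero]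
  | k + 2 => exact hsucc (k + 1) k.succ_ne_zero
  | 1 =>
    rcases eq_or_lt_of_le hpos with h | h
    · obtain ⟨y, hy⟩ := card_eq_one.1 h.symm
      subst hy
      rw [recordMaps_one hm hmax, mem_singleton.1 hm, rootedMaps_singleton]
      simp [recordCount_one]
    · have hn1 : (1 : ℚ) < #S := by exact_mod_cast h
      have hn0 : (#S : ℚ) ≠ 0 := by positivity
      -- Only $k=1$ is still unknown. Its error $e$ is the total error, which root symmetry makes
      -- $\#S\cdot e$; since $\#S>1$, $e=0$.
      have h1 : ∑ k ∈ range (#S + 1), ((#(recordMaps S k) : ℚ) - recordCount #S k) =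
          #(recordMaps S 1) - recordCount #S 1 := by
        refine sum_eq_single 1 ?_ ?_
        · intro k _ hk1
          match k with
          | 0 => simp [recordMaps_zero, recordCount_zero]
          | 1 => exact absurd rfl hk1
          | k + 2 => rw [hsucc (k + 1) k.succ_ne_zero, sub_self]
        · intro h'
          exact absurd (mem_range.2 (by omega)) h'
      rw [sum_sub_distrib, sum_range_recordCount _ hpos, ← Nat.cast_sum, sum_card_recordMaps hm,
        ← recordMaps_one hm hmax, Nat.descFactorial_of_lt (by omega)] at h1
      have h2 : (#S : ℚ) ^ #S / #S = #S * recordCount #S 1 := by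
        rw [recordCount_one]; field_simp
      rw [h2] at h1
      push_cast at h1
      have h3 : ((#S : ℚ) - 1) * (#(recordMaps S 1) - recordCount #S 1) = 0 := by
        linear_combination h1
      rcases mul_eq_zero.1 h3 with h4 | h4
      · linarith
      · linarith

end Count

/-! ### Trees as graphs versus parent maps. -/

section ParentMaps

variable {V : Type*}

/-- The graph joining every node to its image under `p`. -/
def mapGraph (p : V → V) : SimpleGraph V := SimpleGraph.fromRel (fun x y => p x = y)

/-- The map sending every node of a tree to the next one on the path to `r`. -/
noncomputable def parentMap (T : SimpleGraph V) (r : V) (x : V) : V :=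
  if h : T.IsTree then (h.existsUnique_path x r).choose.snd else x

theorem parentMap_eq_snd {T : SimpleGraph V} (hT : T.IsTree) {r x : V} (w : T.Walk x r)
    (hw : w.IsPath) : parentMap T r x = w.snd := by
  rw [parentMap, dif_pos hT]
  exact congrArg _ ((hT.existsUnique_path x r).choose_spec.2 w hw).symm

theorem adj_parentMap {T : SimpleGraph V} (hT : T.IsTree) {r x : V} (hx : x ≠ r) :
    T.Adj x (parentMap T r x) := by
  obtain ⟨w, hw, -⟩ := hT.existsUnique_path x r
  rw [parentMap_eq_snd hT w hw]
  exact w.adj_snd (SimpleGraph.Walk.not_nil_of_ne hx)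

theorem parentMap_self {T : SimpleGraph V} (hT : T.IsTree) (r : V) : parentMap T r r = r :=
  parentMap_eq_snd hT .nil SimpleGraph.Walk.IsPath.nil

theorem exists_iterate_parentMap {T : SimpleGraph V} (hT : T.IsTree) {r x : V} (w : T.Walk x r)
    (hw : w.IsPath) : ∃ i, (parentMap T r)^[i] x = r := by
  induction w with
  | nil => exact ⟨0, rfl⟩
  | cons h w ih =>
    obtain ⟨i, hi⟩ := ih hw.of_cons
    refine ⟨i + 1, ?_⟩
    rw [iterate_succ_apply, parentMap_eq_snd hT _ hw]
    simpa using hi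

theorem isRootedMap_parentMap [Fintype V] {T : SimpleGraph V} (hT : T.IsTree) (r : V) :
    IsRootedMap univ r (parentMap T r) := by
  refine ⟨mem_univ _, parentMap_self hT r, fun x hx => absurd (mem_univ x) hx,
    fun x _ => mem_univ _, fun x _ => ?_⟩
  obtain ⟨w, hw, -⟩ := hT.existsUnique_path x r
  exact exists_iterate_parentMap hT w hw

theorem mapGraph_parentMap_le {T : SimpleGraph V} (hT : T.IsTree) (r : V) :
    mapGraph (parentMap T r) ≤ T := by
  have h : ∀ x y, x ≠ y → parentMap T r x = y → T.Adj x y := by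
    rintro x y hne rfl
    refine adj_parentMap hT ?_
    rintro rfl
    exact hne (parentMap_self hT x).symm
  intro x y hxy
  obtain ⟨hne, hp | hp⟩ := (SimpleGraph.fromRel_adj _ _ _).1 hxy
  · exact h x y hne hp
  · exact (h y x hne.symm hp).symm

variable [Fintype V] {p : V → V} {r x : V}

/-- The orbit of `x` is a path because a non-root node never recurs. It identifies ancestors with
path vertices and the parent with the second vertex. -/
theorem IsRootedMap.exists_isPath (h : IsRootedMap univ r p) (x : V) :
    ∃ w : (mapGraph p).Walk x r, w.IsPath ∧ (∀ y, y ∈ w.support ↔ ∃ i, p^[i] x = y) ∧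
      w.snd = p x := by
  obtain ⟨i, hi⟩ := h.reach x (mem_univ _)
  induction i generalizing x with
  | zero =>
    obtain rfl : x = r := hi
    refine ⟨.nil, SimpleGraph.Walk.IsPath.nil, fun y => ?_, h.map_root.symm⟩
    simp only [SimpleGraph.Walk.support_nil, List.mem_singleton, iterate_fixed h.map_root,
      exists_const]
    exact eq_comm
  | succ i ih =>
    by_cases hxr : x = r
    · subst hxr
      refine ⟨.nil, SimpleGraph.Walk.IsPath.nil, fun y => ?_, h.map_root.symm⟩
      simp only [SimpleGraph.Walk.support_nil, List.mem_singleton, iterate_fixed h.map_root,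
        exists_const]
      exact eq_comm
    · obtain ⟨w, hw, hs, -⟩ := ih (p x) (by rwa [iterate_succ_apply] at hi)
      have hx : x ∉ w.support := by
        rw [hs]
        rintro ⟨j, hj⟩
        exact hxr (h.eq_root_of_iterate (mem_univ _) hj)
      have hadj : (mapGraph p).Adj x (p x) := by
        refine (SimpleGraph.fromRel_adj _ _ _).2 ⟨fun h' => hx ?_, Or.inl rfl⟩
        exact (hs x).2 ⟨0, h'.symm⟩
      refine ⟨.cons hadj w, (SimpleGraph.Walk.cons_isPath_iff _ _).2 ⟨hw, hx⟩, fun y => ?_, by simp⟩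
      rw [SimpleGraph.Walk.support_cons, List.mem_cons, hs]
      constructor
      · rintro (rfl | ⟨j, hj⟩)
        · exact ⟨0, rfl⟩
        · exact ⟨j + 1, by rwa [iterate_succ_apply]⟩
      · rintro ⟨j, hj⟩
        cases j with
        | zero => exact Or.inl hj.symm
        | succ j => exact Or.inr ⟨j, by rwa [iterate_succ_apply] at hj⟩

/-- Each edge joins a non-root node to its parent, so a connected graph has at most $|V|-1$ edges.
-/
theorem IsRootedMap.isTree (h : IsRootedMap univ r p) : (mapGraph p).IsTree := by
  have hconn : (mapGraph p).Connected := by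
    have : Nonempty V := ⟨r⟩
    refine ⟨fun x y => ?_⟩
    obtain ⟨w, -⟩ := h.exists_isPath x
    obtain ⟨w', -⟩ := h.exists_isPath y
    exact ⟨w.append w'.reverse⟩
  refine SimpleGraph.isTree_iff_connected_and_card.2 ⟨hconn, ?_⟩
  refine le_antisymm ?_ hconn.card_vert_le_card_edgeSet_add_one
  have hsub : (mapGraph p).edgeFinset ⊆ (univ.erase r).image (fun x => s(x, p x)) := by
    intro e he
    induction e with
    | _ x y =>
    have hxy : (mapGraph p).Adj x y := by simpa using he
    have hroot : ∀ x, x ≠ p x → x ≠ r := by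
      rintro x hx rfl
      exact hx h.map_root.symm
    obtain ⟨hne, rfl | rfl⟩ := (SimpleGraph.fromRel_adj _ _ _).1 hxy
    · exact mem_image.2 ⟨x, mem_erase.2 ⟨hroot x hne, mem_univ _⟩, rfl⟩
    · exact mem_image.2 ⟨y, mem_erase.2 ⟨hroot y hne.symm, mem_univ _⟩, Sym2.eq_swap⟩
  have hle := (card_le_card hsub).trans card_image_le
  rw [card_erase_of_mem (mem_univ _), card_univ] at hle
  have hpos : 0 < Fintype.card V := Fintype.card_pos_iff.2 ⟨r⟩
  rw [Nat.card_eq_fintype_card, Nat.card_eq_fintype_card, ← SimpleGraph.edgeFinset_card]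
  omega

/-- The left side is a connected subgraph of `T`, and trees are minimal connected graphs. -/
theorem mapGraph_parentMap {T : SimpleGraph V} (hT : T.IsTree) (r : V) :
    mapGraph (parentMap T r) = T :=
  (mapGraph_parentMap_le hT r).antisymm <|
    (SimpleGraph.isTree_iff_minimal_connected.1 hT).2
      (isRootedMap_parentMap hT r).isTree.connected (mapGraph_parentMap_le hT r)

theorem IsRootedMap.parentMap_mapGraph (h : IsRootedMap univ r p) :
    parentMap (mapGraph p) r = p := by
  funext x
  obtain ⟨w, hw, -, hs⟩ := h.exists_isPath x
  rw [parentMap_eq_snd h.isTree w hw, hs]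

theorem IsRootedMap.numTreeRecords_mapGraph {V : Type*} [LinearOrder V] [Fintype V] {p : V → V}
    {r : V} (h : IsRootedMap univ r p) :
    numTreeRecords (mapGraph p) r = #(recordSet univ p) := by
  rw [numTreeRecords, ← Set.ncard_coe_finset]
  congr 1
  ext x
  rw [mem_coe, mem_recordSet, Set.mem_ofPred_eq]
  obtain ⟨w, hw, hs, -⟩ := h.exists_isPath x
  constructor
  · intro hx
    refine ⟨mem_univ _, fun i => hx w.reverse hw.reverse _ ?_⟩
    rw [SimpleGraph.Walk.support_reverse, List.mem_reverse, hs]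
    exact ⟨i, rfl⟩
  · rintro ⟨-, hx⟩ q hq y hy
    have hqw := (h.isTree.existsUnique_path r x).unique hq hw.reverse
    rw [hqw, SimpleGraph.Walk.support_reverse, List.mem_reverse, hs] at hy
    obtain ⟨i, rfl⟩ := hy
    exact hx i

end ParentMaps

theorem treeRecordNumber_eq_card_recordMaps (n k : ℕ) :
    treeRecordNumber n k = #(recordMaps (univ : Finset (Fin n)) k) := by
  rw [treeRecordNumber, ← Set.ncard_coe_finset]
  have key : ((recordMaps (univ : Finset (Fin n)) k : Finset _) : Set (Fin n → Fin n)) =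
      (fun P : SimpleGraph (Fin n) × Fin n => parentMap P.1 P.2) ''
        {P | P.1.IsTree ∧ numTreeRecords P.1 P.2 = k} := by
    ext p
    rw [mem_coe, mem_recordMaps, Set.mem_image]
    constructor
    · rintro ⟨⟨r, h⟩, hc⟩
      exact ⟨(mapGraph p, r), ⟨h.isTree, by rw [h.numTreeRecords_mapGraph, hc]⟩,
        h.parentMap_mapGraph⟩
    · rintro ⟨⟨T, r⟩, ⟨hT, hk⟩, rfl⟩
      have h := isRootedMap_parentMap hT r
      refine ⟨⟨r, h⟩, ?_⟩
      rw [← h.numTreeRecords_mapGraph, mapGraph_parentMap hT, hk]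
  rw [key, Set.InjOn.ncard_image]
  rintro ⟨T, r⟩ ⟨hT, -⟩ ⟨T', r'⟩ ⟨hT', -⟩ heq
  simp only at hT hT' heq
  have h := isRootedMap_parentMap hT r
  have h' := isRootedMap_parentMap hT' r'
  rw [← heq] at h'
  rw [Prod.mk.injEq]
  exact ⟨by rw [← mapGraph_parentMap hT r, heq, mapGraph_parentMap hT' r'], h.root_unique h'⟩

theorem treeRecordNumber_eq_recordCount {n : ℕ} (hn : 1 ≤ n) (k : ℕ) :
    (treeRecordNumber n k : ℚ) = recordCount n k := by
  have : NeZero n := ⟨by omega⟩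
  rw [treeRecordNumber_eq_card_recordMaps, card_recordMaps _ univ_nonempty, card_univ,
    Fintype.card_fin]

/-! ### Unimodality and the location of the last mode. -/

theorem recordCount_nonneg (n k : ℕ) : 0 ≤ recordCount n k := by
  unfold recordCount
  positivity

theorem recordCount_pos {n k : ℕ} (hk : 1 ≤ k) (hkn : k ≤ n) : 0 < recordCount n k := by
  have h1 : 0 < (n - 1).descFactorial (k - 1) := Nat.descFactorial_pos.2 (by omega)
  have h2 : 0 < n := by omega
  unfold recordCount
  positivity

theorem recordCount_eq_zero {n k : ℕ} (hn : 1 ≤ n) (h : n < k) : recordCount n k = 0 := by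
  simp [recordCount, Nat.descFactorial_of_lt (show n - 1 < k - 1 by omega)]

theorem recordCount_le_succ {n k : ℕ} (h : k * (k + 1) ≤ n) :
    recordCount n k ≤ recordCount n (k + 1) := by
  rcases Nat.eq_zero_or_pos k with rfl | hk
  · rw [recordCount_zero]
    exact recordCount_nonneg _ _
  · have hkn : k ≤ n := by nlinarith
    have hpos : (0 : ℚ) < n * k := by
      have : 0 < n := by omega
      positivity
    refine le_of_mul_le_mul_right ?_ hpos
    rw [recordCount_succ_mul hk hkn]
    refine mul_le_mul_of_nonneg_left ?_ (recordCount_nonneg _ _)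
    have : (k : ℚ) * (k + 1) ≤ n := by exact_mod_cast h
    linarith

theorem recordCount_succ_lt {n k : ℕ} (hk : 1 ≤ k) (hkn : k ≤ n) (h : n < k * (k + 1)) :
    recordCount n (k + 1) < recordCount n k := by
  have hpos : (0 : ℚ) < n * k := by
    have : 0 < n := by omega
    positivity
  refine lt_of_mul_lt_mul_right ?_ hpos.le
  rw [recordCount_succ_mul hk hkn]
  refine mul_lt_mul_of_pos_left ?_ (recordCount_pos hk hkn)
  have : (n : ℚ) < k * (k + 1) := by exact_mod_cast h
  linarith

theorem recordCount_succ_le {n k : ℕ} (hn : 1 ≤ n) (h : n < k * (k + 1)) :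
    recordCount n (k + 1) ≤ recordCount n k := by
  rcases le_or_gt k n with hkn | hkn
  · refine (recordCount_succ_lt (Nat.pos_of_ne_zero ?_) hkn h).le
    rintro rfl
    omega
  · rw [recordCount_eq_zero hn (by omega : n < k + 1)]
    exact recordCount_nonneg _ _

theorem recordCount_le_of_le {n K k : ℕ} (hn : 1 ≤ n) (hK : n < K * (K + 1)) (hk : K ≤ k) :
    recordCount n k ≤ recordCount n K := by
  induction k, hk using Nat.le_induction with
  | base => exact le_rfl
  | succ k hk ih =>
    exact (recordCount_succ_le hn (hK.trans_le (Nat.mul_le_mul hk (by omega)))).trans ih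

theorem recordCount_le_of_ge {n K k : ℕ} (hK : K * (K - 1) ≤ n) (hk : k ≤ K) :
    recordCount n k ≤ recordCount n K := by
  induction hk using Nat.decreasingInduction with
  | self => exact le_rfl
  | of_succ k hk ih =>
    refine (recordCount_le_succ (le_trans ?_ hK)).trans ih
    rw [mul_comm K]
    exact Nat.mul_le_mul (by omega) hk

theorem isGreatest_mode_recordCount {n K : ℕ} (hn : 1 ≤ n) (hK : 1 ≤ K) (h1 : K * (K - 1) ≤ n)
    (h2 : n < K * (K + 1)) :
    IsGreatest {k : ℕ | ∀ j : ℕ, recordCount n j ≤ recordCount n k} K := by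
  refine ⟨fun j => (le_total j K).elim (recordCount_le_of_ge h1) (recordCount_le_of_le hn h2),
    fun k hk => ?_⟩
  by_contra! hlt
  -- This makes the value at `K` positive, so the drop after `K` is strict and no larger index is a
  -- mode.
  have hKn : K ≤ n := by
    by_contra! h
    obtain ⟨j, rfl⟩ := Nat.exists_eq_add_of_le' hK
    simp only [Nat.add_sub_cancel] at h1
    nlinarith
  have h3 : recordCount n k ≤ recordCount n (K + 1) :=
    recordCount_le_of_le hn (h2.trans_le (Nat.mul_le_mul (by omega) (by omega))) hlt
  exact absurd (hk K) (not_le.2 (h3.trans_lt (recordCount_succ_lt hK hKn h2)))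

/-- The number under the floor is the positive root of $x^2-x=n$. -/
theorem floor_mode_bounds (n : ℕ) :
    1 ≤ ⌊(1 + Real.sqrt (1 + 4 * (n : ℝ))) / 2⌋₊ ∧
    ⌊(1 + Real.sqrt (1 + 4 * (n : ℝ))) / 2⌋₊ * (⌊(1 + Real.sqrt (1 + 4 * (n : ℝ))) / 2⌋₊ - 1) ≤ n ∧
    n < ⌊(1 + Real.sqrt (1 + 4 * (n : ℝ))) / 2⌋₊ *
      (⌊(1 + Real.sqrt (1 + 4 * (n : ℝ))) / 2⌋₊ + 1) := by
  have hs0 : (0 : ℝ) ≤ 1 + 4 * n := by positivity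
  have hsq := Real.sq_sqrt hs0
  have hs1 : 1 ≤ Real.sqrt (1 + 4 * (n : ℝ)) :=
    Real.one_le_sqrt.2 (by linarith [n.cast_nonneg (α := ℝ)])
  have hle := Nat.floor_le (show 0 ≤ (1 + Real.sqrt (1 + 4 * (n : ℝ))) / 2 by positivity)
  have hlt := Nat.lt_floor_add_one ((1 + Real.sqrt (1 + 4 * (n : ℝ))) / 2)
  have hone : 1 ≤ ⌊(1 + Real.sqrt (1 + 4 * (n : ℝ))) / 2⌋₊ :=
    Nat.le_floor (by push_cast; linarith)
  generalize ⌊(1 + Real.sqrt (1 + 4 * (n : ℝ))) / 2⌋₊ = K at *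
  generalize Real.sqrt (1 + 4 * (n : ℝ)) = s at *
  obtain ⟨j, rfl⟩ := Nat.exists_eq_add_of_le' hone
  refine ⟨hone, ?_, ?_⟩
  · rw [Nat.add_sub_cancel]
    push_cast at hle
    have : (((j + 1) * j : ℕ) : ℝ) ≤ n := by
      push_cast
      nlinarith [j.cast_nonneg (α := ℝ)]
    exact_mod_cast this
  · push_cast at hlt
    have : (n : ℝ) < ((j + 1) * (j + 1 + 1) : ℕ) := by
      push_cast
      nlinarith [j.cast_nonneg (α := ℝ)]
    exact_mod_cast this

theorem mainTheorem11 (n : ℕ) (hn : 1 ≤ n) :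
    IsGreatest {k : ℕ | ∀ j : ℕ, treeRecordNumber n j ≤ treeRecordNumber n k}
      ⌊(1 + Real.sqrt (1 + 4 * (n : ℝ))) / 2⌋₊ := by
  obtain ⟨h0, h1, h2⟩ := floor_mode_bounds n
  have hiff : ∀ j k, treeRecordNumber n j ≤ treeRecordNumber n k ↔
      recordCount n j ≤ recordCount n k := by
    intro j k
    rw [← treeRecordNumber_eq_recordCount hn, ← treeRecordNumber_eq_recordCount hn, Nat.cast_le]
  simp only [hiff]
  exact isGreatest_mode_recordCount hn h0 h1 h2
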